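/- Let $1\le q\le n+1$ and let $\mathbb R^{n+1}_q$ be $\mathbb R^{n+1}$ with coordinates $(x^0,\dots,x^n)$ and the metric $\bar g=\sum_{i=0}^n\varepsilon_i(dx^i)^2$, where $\varepsilon_i=-1$ for $0\le i\le q-1$ and $\varepsilon_i=1$ for $q\le i\le n$. Let $D\subset\mathbb R^n$ be open, let $F:D\to\mathbb R$ be a smooth nowhere vanishing function, and let $x:D\to\mathbb R^{n+1}$, $x(u)=(F(u),u^1,\dots,u^n)$, be the corresponding Monge hypersurface $M=x(D)$ (identified with $D$ through $x$), with induced tensor $g=x^\star\bar g$. Assume that $M$ is null, i.e. $g$ is degenerate at every point. Let $$\mathscr N_F=\frac1{\sqrt2}\Big[-\frac{\partial}{\partial x^0}+\sum_{a=1}^n\varepsilon_a\frac{\partial F}{\partial u^a}\frac{\partial}{\partial x^a}\Big]$$ be the generic UCC-rigging, regarded as a vector field on the open set $\mathbb R\times D\subset\mathbb R^{n+1}$ (independent of $x^0$), and put $\bar\eta=\bar g(\mathscr N_F,\cdot)$, $\eta=x^\star\bar\eta$, $\bar g_1=\bar g+\bar\eta\otimes\bar\eta$ on $\mathbb R\times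 D$, and $g_1=g+\eta\otimes\eta$ on $M$. Then $(\mathbb R\times D,\bar g_1)$ and $(M,g_1)$ are semi-Riemannian manifolds, $x:(M,g_1)\to(\mathbb R\times D,\bar g_1)$ is an isometrically immersed (embedded) non-degenerate hypersurface admitting a global smooth unit normal field, and it is totally geodesic: for every smooth unit normal field $\delta$ along $x$, over any open subset of $M$, the shape operator $X\mapsto-\bar\nabla^1_X\delta$ vanishes identically, where $\bar\nabla^1$ is the Levi-Civita connection of $\bar g_1$. -/

import Mathlib

open scoped ContDiff

noncomputable section

/-! ### Tensor fields and semi-Riemannian metrics on open subsets of `ℝ^m`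

Everything is written in the global rectangular coordinates; every tangent space of an open subset
of `ℝ^m` is `Fin m → ℝ` (only the smooth structure of `Fin m → ℝ` is used, never its norm). -/

/-- A field of bilinear forms on `ℝ^m` (a `(0,2)`-tensor field). -/
abbrev BilinField (m : ℕ) : Type := (Fin m → ℝ) → LinearMap.BilinForm ℝ (Fin m → ℝ)

/-- `g` is a semi-Riemannian metric on the open set `U`: smooth, symmetric, non-degenerate, and of
constant index (the maximal dimension of a negative definite subspace). -/
structure IsSemiRiemannianOn {m : ℕ} (g : BilinField m) (U : Set (Fin m → ℝ)) : Prop where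
  smooth : ∀ v w : Fin m → ℝ, ContDiffOn ℝ ∞ (fun y => g y v w) U
  symm : ∀ y ∈ U, ∀ v w : Fin m → ℝ, g y v w = g y w v
  nondegenerate : ∀ y ∈ U, ∀ v : Fin m → ℝ, (∀ w, g y v w = 0) → v = 0
  constant_index : ∃ ν : ℕ, ∀ y ∈ U, sigNeg (g y).toQuadraticMap = ν

/-- `g` is degenerate at every point of `U`. -/
def IsNullOn {m : ℕ} (g : BilinField m) (U : Set (Fin m → ℝ)) : Prop :=
  ∀ y ∈ U, ∃ u : Fin m → ℝ, u ≠ 0 ∧ ∀ v : Fin m → ℝ, g y u v = 0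

/-- The pullback `f^* g` of a bilinear form field. -/
def pullback {d m : ℕ} (f : (Fin d → ℝ) → (Fin m → ℝ)) (g : BilinField m) : BilinField d :=
  fun p => (g (f p)).compl₁₂ (fderiv ℝ f p).toLinearMap (fderiv ℝ f p).toLinearMap

/-- The pullback `f^* η` of a `1`-form. -/
def pullbackForm {d m : ℕ} (f : (Fin d → ℝ) → (Fin m → ℝ))
    (η : (Fin m → ℝ) → ((Fin m → ℝ) →ₗ[ℝ] ℝ)) : (Fin d → ℝ) → ((Fin d → ℝ) →ₗ[ℝ] ℝ) :=
  fun p => (η (f p)).comp (fderiv ℝ f p).toLinearMap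

/-- The `1`-form `v ↦ g(N, v)` that is `g`-metrically equivalent to the vector field `N`. -/
def flatForm {m : ℕ} (g : BilinField m) (N : (Fin m → ℝ) → (Fin m → ℝ)) :
    (Fin m → ℝ) → ((Fin m → ℝ) →ₗ[ℝ] ℝ) :=
  fun y => g y (N y)

/-- The perturbation `g + α η ⊗ η`. -/
def perturb {m : ℕ} (g : BilinField m) (η : (Fin m → ℝ) → ((Fin m → ℝ) →ₗ[ℝ] ℝ))
    (α : (Fin m → ℝ) → ℝ) : BilinField m :=
  fun y => g y + α y • (η y).smulRight (η y)

/-- The `α`-twisted metric `g + α η̄ ⊗ η̄`, where `η̄ = g(N, ·)`. -/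
def twistedMetric {m : ℕ} (g : BilinField m) (N : (Fin m → ℝ) → (Fin m → ℝ))
    (α : (Fin m → ℝ) → ℝ) : BilinField m :=
  perturb g (flatForm g N) α

/-- The `α`-associated metric of the immersion `f` with rigging `N`, namely
`f^* g + (α ∘ f) η ⊗ η`, where `η = f^* η̄` and `η̄ = g(N, ·)`. -/
def associatedMetric {d m : ℕ} (f : (Fin d → ℝ) → (Fin m → ℝ)) (g : BilinField m)
    (N : (Fin m → ℝ) → (Fin m → ℝ)) (α : (Fin m → ℝ) → ℝ) : BilinField d :=
  perturb (pullback f g) (pullbackForm f (flatForm g N)) (α ∘ f)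

/-! ### Levi-Civita connection and hypersurfaces -/

/-- The matrix `(g_{ij})` of the components of `g` at `y`. -/
def components {m : ℕ} (g : BilinField m) (y : Fin m → ℝ) : Matrix (Fin m) (Fin m) ℝ :=
  Matrix.of fun i j => g y (Pi.single i 1) (Pi.single j 1)

/-- The partial derivative `∂_i h` at `y`. -/
def partialDeriv {m : ℕ} (i : Fin m) (h : (Fin m → ℝ) → ℝ) (y : Fin m → ℝ) : ℝ :=
  fderiv ℝ h y (Pi.single i 1)

/-- The Christoffel symbols
`Γ^k_{ij} = (1/2) g^{kl} (∂_i g_{jl} + ∂_j g_{il} - ∂_l g_{ij})` of the Levi-Civita connection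
of `g`. -/
def christoffel {m : ℕ} (g : BilinField m) (y : Fin m → ℝ) (k i j : Fin m) : ℝ :=
  (1 / 2) * ∑ l, (components g y)⁻¹ k l *
    (partialDeriv i (fun z => components g z j l) y
      + partialDeriv j (fun z => components g z i l) y
      - partialDeriv l (fun z => components g z i j) y)

/-- The Levi-Civita covariant derivative, in the direction of the tangent vector `u` at `p`, of a
vector field `V` along the map `f` (so `V p` is a tangent vector at `f p`):
`dV^k(u) + Γ^k_{ij}(f p) (df u)^i V^j`. -/
def covDerivAlong {d m : ℕ} (g : BilinField m) (f V : (Fin d → ℝ) → (Fin m → ℝ))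
    (p u : Fin d → ℝ) : Fin m → ℝ :=
  fun k => fderiv ℝ V p u k
    + ∑ i, ∑ j, christoffel g (f p) k i j * fderiv ℝ f p u i * V p j

/-- `δ` is a smooth unit normal field (Gauss map) along `f` over the set `V`. -/
structure IsUnitNormalOn {d m : ℕ} (g : BilinField m) (f δ : (Fin d → ℝ) → (Fin m → ℝ))
    (V : Set (Fin d → ℝ)) : Prop where
  smooth : ContDiffOn ℝ ∞ δ V
  normal : ∀ p ∈ V, ∀ u : Fin d → ℝ, g (f p) (δ p) (fderiv ℝ f p u) = 0
  unit : ∀ p ∈ V, |g (f p) (δ p) (δ p)| = 1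

/-- The shape operator `u ↦ -∇_u δ` of the immersion `f` with respect to the unit normal field `δ`,
with values in the tangent space of the ambient space (in fact in the image of `df`). -/
def shapeOperator {d m : ℕ} (g : BilinField m) (f δ : (Fin d → ℝ) → (Fin m → ℝ))
    (p u : Fin d → ℝ) : Fin m → ℝ :=
  -covDerivAlong g f δ p u

/-- `f : (D, h) → (U, g)` is a non-degenerate (embedded) hypersurface, isometrically immersed in
the semi-Riemannian manifold `(U, g)`. -/
structure IsNondegenerateHypersurface {n : ℕ} (D : Set (Fin n → ℝ)) (h : BilinField n)
    (U : Set (Fin (n + 1) → ℝ)) (g : BilinField (n + 1))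
    (f : (Fin n → ℝ) → (Fin (n + 1) → ℝ)) : Prop where
  ambient_metric : IsSemiRiemannianOn g U
  metric : IsSemiRiemannianOn h D
  smooth : ContDiffOn ℝ ∞ f D
  mapsTo : Set.MapsTo f D U
  immersion : ∀ p ∈ D, Function.Injective (fderiv ℝ f p)
  embedding : Topology.IsEmbedding (D.domRestrict f)
  isometric : ∀ p ∈ D, h p = pullback f g p

/-- The hypersurface `f : D → (U, g)` is totally geodesic: the shape operator with respect to every
local unit normal field vanishes identically. -/
def IsTotallyGeodesic {n : ℕ} (D : Set (Fin n → ℝ)) (g : BilinField (n + 1))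
    (f : (Fin n → ℝ) → (Fin (n + 1) → ℝ)) : Prop :=
  ∀ (V : Set (Fin n → ℝ)) (δ : (Fin n → ℝ) → (Fin (n + 1) → ℝ)), IsOpen V → V ⊆ D →
    IsUnitNormalOn g f δ V → ∀ p ∈ V, ∀ u : Fin n → ℝ, shapeOperator g f δ p u = 0

/-! ### Monge hypersurfaces of the semi-Euclidean space `ℝ^{n+1}_q` -/

/-- The sign `ε_i`: `-1` for `0 ≤ i ≤ q - 1` and `+1` for `q ≤ i`. -/
def eps (q i : ℕ) : ℝ := if i < q then -1 else 1

/-- The canonical metric `ε_i (dx^i)^2` of `ℝ^m_q`. -/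
def semiEuclideanMetric (m q : ℕ) : BilinField m :=
  fun _ => Matrix.toBilin' (Matrix.diagonal fun i : Fin m => eps q i)

/-- The immersion `(u^1, …, u^n) ↦ (F u, u^1, …, u^n)`. -/
def mongeMap {n : ℕ} (F : (Fin n → ℝ) → ℝ) (p : Fin n → ℝ) : Fin (n + 1) → ℝ :=
  Fin.cons (F p) p

/-- The cylinder `ℝ × D`, as a set of points `(x^0, x^1, …, x^n)`. -/
def cylinder {n : ℕ} (D : Set (Fin n → ℝ)) : Set (Fin (n + 1) → ℝ) :=
  {y | Fin.tail y ∈ D}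

/-- The generic UCC-rigging `(1/√2) (-∂_{x^0} + ε^a F'_{u^a} ∂_{x^a})` on `ℝ × D`, where the index
`a` runs over `1, …, n`; it does not depend on `x^0`. -/
def uccRigging {n : ℕ} (q : ℕ) (F : (Fin n → ℝ) → ℝ) (y : Fin (n + 1) → ℝ) : Fin (n + 1) → ℝ :=
  (1 / √2 : ℝ) •
    (Fin.cons (-1) (fun a : Fin n => eps q a.succ * partialDeriv a F (Fin.tail y)) :
      Fin (n + 1) → ℝ)

end

open scoped ContDiff

/-! ### Rank one perturbations of symmetric bilinear forms -/

/-! Write `h` for `∑ ε_a (du^a)²`. Nullness of the graph is the eikonal equation `dF(grad F) = 1`,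
with gradient taken in `h` (`fderiv_tailGrad_of_null`). Since `η̄ = (dx⁰ + dF)/√2`, the ambient
metric is `-(dx⁰)² + h + (dx⁰ + dF)²/2`, and it pulls back to `h + dF²`. Both are rank one
perturbations of non-degenerate forms along a vector of square 0, respectively 1 (by the eikonal
equation), so they stay non-degenerate with the same index.

The field `∂_{x⁰}` is metrically dual to `d(F - x⁰)/2`, hence normal to the graph `x⁰ = F`. This
dual form is closed and the metric does not depend on `x⁰`, so `∂_{x⁰}` is parallel
(`christoffel_twistedMetric_zero`). Every unit normal is locally `±√2 ∂_{x⁰}`, so its covariant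
derivative vanishes. -/

lemma sigNeg_toQuadraticMap_eq_of_injective {V : Type*} [AddCommGroup V] [Module ℝ V]
    [FiniteDimensional ℝ V] (b b' : LinearMap.BilinForm ℝ V) (A : V →ₗ[ℝ] V)
    (hA : Function.Injective A) (h : ∀ v, b (A v) (A v) = b' v v) :
    sigNeg b'.toQuadraticMap = sigNeg b.toQuadraticMap := by
  refine QuadraticMap.Equivalent.sigNeg_eq
    ⟨{ LinearEquiv.ofInjectiveEndo A hA with map_app' := fun v => ?_ }⟩
  simpa using h v

/-- The map `v ↦ v + c b(N, v) N` carries `b'` to `b`: expanding the square gives the coefficient `c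
(2 + c b(N, N))` on `b(N, v)²`. It multiplies `b(N, ·)` by `1 + c b(N, N)`, hence is injective when
this is nonzero. -/
lemma sigNeg_toQuadraticMap_add_sq {V : Type*} [AddCommGroup V] [Module ℝ V]
    [FiniteDimensional ℝ V] (b b' : LinearMap.BilinForm ℝ V) (N : V)
    (hsymm : ∀ v w, b v w = b w v) (c : ℝ) (hc : c * (2 + c * b N N) = 1)
    (hc' : 1 + c * b N N ≠ 0) (h : ∀ v, b' v v = b v v + b N v * b N v) :
    sigNeg b'.toQuadraticMap = sigNeg b.toQuadraticMap := by
  refine sigNeg_toQuadraticMap_eq_of_injective b b'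
    (LinearMap.id + (c • b N).smulRight N) ?_ fun v => ?_
  · rw [← LinearMap.ker_eq_bot, LinearMap.ker_eq_bot']
    intro v hv
    simp only [LinearMap.add_apply, LinearMap.id_apply, LinearMap.smulRight_apply,
      LinearMap.smul_apply, smul_eq_mul] at hv
    have h1 : b N v = 0 := by
      have := congrArg (b N) hv
      simp only [map_add, map_smul, smul_eq_mul, map_zero] at this
      have h2 : b N v * (1 + c * b N N) = 0 := by linear_combination this
      exact (mul_eq_zero.mp h2).resolve_right hc'
    simpa [h1] using hv
  · rw [h]
    simp only [LinearMap.add_apply, LinearMap.id_apply, LinearMap.smulRight_apply,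
      LinearMap.smul_apply, smul_eq_mul, map_add, map_smul]
    rw [hsymm v N]
    linear_combination (b N v) ^ 2 * hc

/-- Testing against `w = N` gives `b(N, v) (1 + b(N, N)) = 0`, which kills the perturbation term. -/
lemma eq_zero_of_forall_add_mul_eq_zero {V : Type*} [AddCommGroup V] [Module ℝ V]
    (b : LinearMap.BilinForm ℝ V) (N : V) (hsymm : ∀ v w, b v w = b w v)
    (hb : ∀ v, (∀ w, b v w = 0) → v = 0) (hN : 1 + b N N ≠ 0) (v : V)
    (hv : ∀ w, b v w + b N v * b N w = 0) : v = 0 := by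
  have h0 : b N v = 0 := by
    have h1 : b N v * (1 + b N N) = 0 := by
      have := hv N
      rw [hsymm v N] at this
      linear_combination this
    exact (mul_eq_zero.mp h1).resolve_right hN
  exact hb v fun w => by simpa [h0] using hv w

/-! ### Diagonal forms with signs -/

lemma eps_mul_self (q i : ℕ) : eps q i * eps q i = 1 := by
  unfold eps; split_ifs <;> norm_num

/-- The metric `∑ ε_a (du^a)^2` on `ℝ^n`, where `a` runs over `1, …, n`. -/
noncomputable def tailForm (n q : ℕ) : LinearMap.BilinForm ℝ (Fin n → ℝ) :=
  Matrix.toBilin' (Matrix.diagonal fun a : Fin n => eps q a.succ)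

lemma toBilin'_diagonal_apply {m : ℕ} (d v w : Fin m → ℝ) :
    Matrix.toBilin' (Matrix.diagonal d) v w = ∑ i, d i * v i * w i := by
  rw [Matrix.toBilin'_apply']
  simp only [Matrix.mulVec_diagonal, dotProduct]
  exact Finset.sum_congr rfl fun i _ => by ring

lemma eq_zero_of_forall_toBilin'_diagonal {m : ℕ} (d : Fin m → ℝ) (hd : ∀ i, d i ≠ 0)
    (v : Fin m → ℝ) (hv : ∀ w, Matrix.toBilin' (Matrix.diagonal d) v w = 0) : v = 0 := by
  ext i
  have := hv (Pi.single i 1)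
  rw [toBilin'_diagonal_apply] at this
  simpa [Pi.single_apply, hd i] using this

lemma eps_ne_zero (q i : ℕ) : eps q i ≠ 0 := left_ne_zero_of_mul_eq_one (eps_mul_self q i)

lemma tailForm_symm (n q : ℕ) (v w : Fin n → ℝ) : tailForm n q v w = tailForm n q w v := by
  simp only [tailForm, toBilin'_diagonal_apply]
  exact Finset.sum_congr rfl fun i _ => by ring

lemma semiEuclideanMetric_symm (m q : ℕ) (y v w : Fin m → ℝ) :
    semiEuclideanMetric m q y v w = semiEuclideanMetric m q y w v := by
  simp only [semiEuclideanMetric, toBilin'_diagonal_apply]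
  exact Finset.sum_congr rfl fun i _ => by ring

lemma semiEuclideanMetric_succ {n q : ℕ} (hq : 0 < q) (y v w : Fin (n + 1) → ℝ) :
    semiEuclideanMetric (n + 1) q y v w
      = -(v 0 * w 0) + tailForm n q (Fin.tail v) (Fin.tail w) := by
  simp only [semiEuclideanMetric, tailForm, toBilin'_diagonal_apply, Fin.sum_univ_succ, Fin.tail]
  simp [eps, hq]

lemma tailForm_nondegenerate {n q : ℕ} (v : Fin n → ℝ) (hv : ∀ w, tailForm n q v w = 0) :
    v = 0 :=
  eq_zero_of_forall_toBilin'_diagonal _ (fun _ => eps_ne_zero _ _) v hv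

lemma semiEuclideanMetric_nondegenerate {m q : ℕ} (y v : Fin m → ℝ)
    (hv : ∀ w, semiEuclideanMetric m q y v w = 0) : v = 0 :=
  eq_zero_of_forall_toBilin'_diagonal _ (fun _ => eps_ne_zero _ _) v hv

/-! ### Metrics attached to a Monge hypersurface -/

section Monge

variable {n q : ℕ} {D : Set (Fin n → ℝ)} {F : (Fin n → ℝ) → ℝ}

/-- The gradient `ε^a ∂_a F` with respect to `tailForm n q`. -/
noncomputable def tailGrad (q : ℕ) (F : (Fin n → ℝ) → ℝ) (p : Fin n → ℝ) : Fin n → ℝ :=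
  fun a => eps q a.succ * partialDeriv a F p

lemma tailForm_tailGrad (p v : Fin n → ℝ) :
    tailForm n q (tailGrad q F p) v = fderiv ℝ F p v := by
  rw [tailForm, toBilin'_diagonal_apply]
  conv_rhs => rw [pi_eq_sum_univ' v]
  simp only [map_sum, map_smul, tailGrad, partialDeriv, smul_eq_mul]
  refine Finset.sum_congr rfl fun i _ => ?_
  linear_combination (fderiv ℝ F p (Pi.single i 1) * v i) * eps_mul_self q (i.succ : Fin (n + 1))

lemma flatForm_uccRigging (hq : 0 < q) (y v : Fin (n + 1) → ℝ) :
    flatForm (semiEuclideanMetric (n + 1) q) (uccRigging q F) y v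
      = 1 / √2 * (v 0 + fderiv ℝ F (Fin.tail y) (Fin.tail v)) := by
  rw [← tailForm_tailGrad (q := q), flatForm, uccRigging, map_smul, LinearMap.smul_apply,
    semiEuclideanMetric_succ hq, Fin.cons_zero, Fin.tail_cons, smul_eq_mul]
  change 1 / √2 * (-(-1 * v 0) + tailForm n q (tailGrad q F (Fin.tail y)) (Fin.tail v)) = _
  ring

lemma one_div_sqrt_two_mul_self : (1 / √2 : ℝ) * (1 / √2) = 1 / 2 := by
  rw [div_mul_div_comm, Real.mul_self_sqrt (by norm_num), one_mul]

lemma twistedMetric_uccRigging (hq : 0 < q) (y v w : Fin (n + 1) → ℝ) :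
    twistedMetric (semiEuclideanMetric (n + 1) q) (uccRigging q F) (fun _ => 1) y v w
      = -(v 0 * w 0) + tailForm n q (Fin.tail v) (Fin.tail w)
        + 1 / 2 * (v 0 + fderiv ℝ F (Fin.tail y) (Fin.tail v))
          * (w 0 + fderiv ℝ F (Fin.tail y) (Fin.tail w)) := by
  simp only [twistedMetric, perturb, one_smul, LinearMap.add_apply, LinearMap.smulRight_apply,
    smul_eq_mul, LinearMap.smul_apply]
  rw [flatForm_uccRigging hq, flatForm_uccRigging hq, semiEuclideanMetric_succ hq]
  linear_combination (v 0 + fderiv ℝ F (Fin.tail y) (Fin.tail v))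
    * (w 0 + fderiv ℝ F (Fin.tail y) (Fin.tail w)) * one_div_sqrt_two_mul_self

lemma fderiv_mongeMap {p : Fin n → ℝ} (hF : DifferentiableAt ℝ F p) (v : Fin n → ℝ) :
    fderiv ℝ (mongeMap F) p v = Fin.cons (fderiv ℝ F p v) v := by
  have h : HasFDerivAt (mongeMap F)
      ((fderiv ℝ F p).finCons (ContinuousLinearMap.id ℝ (Fin n → ℝ))) p :=
    hasFDerivAt_finCons'.2 ⟨hF.hasFDerivAt, hasFDerivAt_id p⟩
  rw [h.fderiv]
  rfl

lemma pullback_mongeMap (hq : 0 < q) {p : Fin n → ℝ} (hF : DifferentiableAt ℝ F p)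
    (v w : Fin n → ℝ) :
    pullback (mongeMap F) (semiEuclideanMetric (n + 1) q) p v w
      = -(fderiv ℝ F p v * fderiv ℝ F p w) + tailForm n q v w := by
  simp only [pullback, LinearMap.compl₁₂_apply, ContinuousLinearMap.coe_coe]
  rw [semiEuclideanMetric_succ hq, fderiv_mongeMap hF, fderiv_mongeMap hF]
  simp

/-- Pullback commutes with sums and tensor squares; this is the isometry of the immersion. -/
lemma associatedMetric_eq_pullback {d m : ℕ} (f : (Fin d → ℝ) → (Fin m → ℝ)) (g : BilinField m)
    (N : (Fin m → ℝ) → (Fin m → ℝ)) (α : (Fin m → ℝ) → ℝ) :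
    associatedMetric f g N α = pullback f (twistedMetric g N α) := by
  rfl

lemma associatedMetric_uccRigging (hq : 0 < q) {p : Fin n → ℝ} (hF : DifferentiableAt ℝ F p)
    (v w : Fin n → ℝ) :
    associatedMetric (mongeMap F) (semiEuclideanMetric (n + 1) q) (uccRigging q F)
        (fun _ => 1) p v w
      = tailForm n q v w + fderiv ℝ F p v * fderiv ℝ F p w := by
  rw [associatedMetric_eq_pullback]
  simp only [pullback, LinearMap.compl₁₂_apply, ContinuousLinearMap.coe_coe]
  rw [twistedMetric_uccRigging hq, fderiv_mongeMap hF, fderiv_mongeMap hF]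
  simp only [mongeMap, Fin.cons_zero, Fin.tail_cons]
  ring

/-- The eikonal equation `∑ ε_a (∂_a F)^2 = 1` of null Monge hypersurfaces. -/
lemma fderiv_tailGrad_of_null (hq : 0 < q) {p : Fin n → ℝ} (hF : DifferentiableAt ℝ F p)
    (hnull : ∃ u : Fin n → ℝ, u ≠ 0 ∧
      ∀ v, pullback (mongeMap F) (semiEuclideanMetric (n + 1) q) p u v = 0) :
    fderiv ℝ F p (tailGrad q F p) = 1 := by
  obtain ⟨u, hu, h⟩ := hnull
  simp only [pullback_mongeMap hq hF] at h
  -- If `dF(u) = 0`, the degenerate direction `u` would lie in the radical of `tailForm`. Pairing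
  -- `u` with the gradient then gives `dF(u) (1 - dF(grad F)) = 0`.
  have h0 : fderiv ℝ F p u ≠ 0 := fun h0 =>
    hu (tailForm_nondegenerate u fun w => by simpa [h0] using h w)
  have h1 := h (tailGrad q F p)
  rw [tailForm_symm, tailForm_tailGrad] at h1
  exact mul_left_cancel₀ h0 (by linear_combination -h1)

/-! ### Smoothness, non-degeneracy and index of the two metrics -/

lemma contDiff_finTail : ContDiff ℝ ∞ (Fin.tail : (Fin (n + 1) → ℝ) → (Fin n → ℝ)) :=
  contDiff_pi.2 fun i => contDiff_apply ℝ ℝ i.succ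

lemma contDiffOn_fderiv_apply (hD : IsOpen D) (hF : ContDiffOn ℝ ∞ F D) (v : Fin n → ℝ) :
    ContDiffOn ℝ ∞ (fun p => fderiv ℝ F p v) D :=
  (hF.fderiv_of_isOpen hD (by simp)).clm_apply contDiffOn_const

lemma isSemiRiemannianOn_twistedMetric_uccRigging (hq : 0 < q) (hD : IsOpen D)
    (hF : ContDiffOn ℝ ∞ F D)
    (hgrad : ∀ p ∈ D, fderiv ℝ F p (tailGrad q F p) = 1) :
    IsSemiRiemannianOn
      (twistedMetric (semiEuclideanMetric (n + 1) q) (uccRigging q F) (fun _ => 1))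
      (cylinder D) := by
  have happ : ∀ y v w,
      twistedMetric (semiEuclideanMetric (n + 1) q) (uccRigging q F) (fun _ => 1) y v w
        = semiEuclideanMetric (n + 1) q y v w
          + semiEuclideanMetric (n + 1) q y (uccRigging q F y) v
            * semiEuclideanMetric (n + 1) q y (uccRigging q F y) w := by
    intro y v w
    simp [twistedMetric, perturb, flatForm]
  -- The rigging is null: its square is `(-1 + dF(grad F))/2`.
  have hnull : ∀ y ∈ cylinder D,
      semiEuclideanMetric (n + 1) q y (uccRigging q F y) (uccRigging q F y) = 0 := by
    intro y hy
    have h1 := flatForm_uccRigging (F := F) hq y (uccRigging q F y)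
    have h2 : Fin.tail (uccRigging q F y) = (1 / √2 : ℝ) • tailGrad q F (Fin.tail y) := rfl
    have h3 : uccRigging q F y 0 = (1 / √2 : ℝ) * (-1) := rfl
    rw [h2, h3, map_smul, hgrad _ hy] at h1
    simpa [flatForm] using h1
  refine ⟨fun v w => ?_, fun y _ v w => ?_, fun y hy v hv => ?_, ?_⟩
  · simp only [twistedMetric_uccRigging hq]
    have h : ∀ v : Fin n → ℝ,
        ContDiffOn ℝ ∞ (fun y : Fin (n + 1) → ℝ => fderiv ℝ F (Fin.tail y) v) (cylinder D) :=
      fun v => (contDiffOn_fderiv_apply hD hF v).comp contDiff_finTail.contDiffOn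
        fun _ hy => hy
    exact contDiffOn_const.add ((contDiffOn_const.mul (contDiffOn_const.add (h _))).mul
      (contDiffOn_const.add (h _)))
  · rw [happ, happ, semiEuclideanMetric_symm _ _ y v w, mul_comm]
  · refine eq_zero_of_forall_add_mul_eq_zero (semiEuclideanMetric (n + 1) q y) (uccRigging q F y)
      (semiEuclideanMetric_symm _ _ y) (semiEuclideanMetric_nondegenerate y) ?_ v
      fun w => by rw [← happ, hv]
    rw [hnull y hy]
    norm_num
  · refine ⟨sigNeg (semiEuclideanMetric (n + 1) q 0).toQuadraticMap, fun y hy => ?_⟩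
    refine sigNeg_toQuadraticMap_add_sq (semiEuclideanMetric (n + 1) q y) _ (uccRigging q F y)
      (semiEuclideanMetric_symm _ _ y) (1 / 2) ?_ ?_ fun v => happ y v v
    · rw [hnull y hy]; norm_num
    · rw [hnull y hy]; norm_num

lemma isSemiRiemannianOn_associatedMetric_uccRigging (hq : 0 < q) (hD : IsOpen D)
    (hF : ContDiffOn ℝ ∞ F D)
    (hgrad : ∀ p ∈ D, fderiv ℝ F p (tailGrad q F p) = 1) :
    IsSemiRiemannianOn
      (associatedMetric (mongeMap F) (semiEuclideanMetric (n + 1) q) (uccRigging q F)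
        (fun _ => 1)) D := by
  have hdiff : ∀ p ∈ D, DifferentiableAt ℝ F p := fun p hp =>
    (hF.differentiableOn (by simp)).differentiableAt (hD.mem_nhds hp)
  have hnorm : ∀ p ∈ D, tailForm n q (tailGrad q F p) (tailGrad q F p) = 1 := fun p hp => by
    rw [tailForm_tailGrad, hgrad p hp]
  refine ⟨fun v w => ?_, fun p hp v w => ?_, fun p hp v hv => ?_, ?_⟩
  · refine ContDiffOn.congr (f := fun p => tailForm n q v w + fderiv ℝ F p v * fderiv ℝ F p w) ?_
      fun p hp => associatedMetric_uccRigging hq (hdiff p hp) v w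
    exact contDiffOn_const.add
      ((contDiffOn_fderiv_apply hD hF v).mul (contDiffOn_fderiv_apply hD hF w))
  · rw [associatedMetric_uccRigging hq (hdiff p hp), associatedMetric_uccRigging hq (hdiff p hp),
      tailForm_symm, mul_comm]
  · refine eq_zero_of_forall_add_mul_eq_zero (tailForm n q) (tailGrad q F p) (tailForm_symm n q)
      tailForm_nondegenerate ?_ v fun w => ?_
    · rw [hnorm p hp]; norm_num
    · rw [tailForm_tailGrad, tailForm_tailGrad, ← associatedMetric_uccRigging hq (hdiff p hp), hv]
  · refine ⟨sigNeg (tailForm n q).toQuadraticMap, fun p hp => ?_⟩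
    have hs : √2 * √2 = (2 : ℝ) := Real.mul_self_sqrt (by norm_num)
    -- `√2 - 1` is a root of `c (2 + c) = 1`, the gradient having square 1.
    refine sigNeg_toQuadraticMap_add_sq (tailForm n q) _ (tailGrad q F p) (tailForm_symm n q)
      (√2 - 1) ?_ ?_ fun v => ?_
    · rw [hnorm p hp]; linear_combination hs
    · rw [hnorm p hp]; simp
    · rw [associatedMetric_uccRigging hq (hdiff p hp), tailForm_tailGrad]

lemma isNondegenerateHypersurface_mongeMap (hq : 0 < q) (hD : IsOpen D)
    (hF : ContDiffOn ℝ ∞ F D)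
    (hgrad : ∀ p ∈ D, fderiv ℝ F p (tailGrad q F p) = 1) :
    IsNondegenerateHypersurface D
      (associatedMetric (mongeMap F) (semiEuclideanMetric (n + 1) q) (uccRigging q F) (fun _ => 1))
      (cylinder D)
      (twistedMetric (semiEuclideanMetric (n + 1) q) (uccRigging q F) (fun _ => 1))
      (mongeMap F) where
  ambient_metric := isSemiRiemannianOn_twistedMetric_uccRigging hq hD hF hgrad
  metric := isSemiRiemannianOn_associatedMetric_uccRigging hq hD hF hgrad
  smooth := contDiffOn_pi.2 fun i => Fin.cases hF (fun a => (contDiff_apply ℝ ℝ a).contDiffOn) i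
  mapsTo := fun p hp => by simpa [cylinder, mongeMap] using hp
  immersion := fun p hp v w h => by
    have hd := (hF.differentiableOn (by simp)).differentiableAt (hD.mem_nhds hp)
    rw [fderiv_mongeMap hd, fderiv_mongeMap hd] at h
    exact (Fin.cons_inj.1 h).2
  embedding := by
    -- Dropping `x⁰` is a continuous left inverse of the graph map.
    refine Topology.IsEmbedding.of_comp (g := (Fin.tail : (Fin (n + 1) → ℝ) → (Fin n → ℝ)))
      ?_ contDiff_finTail.continuous ?_
    · exact continuous_pi fun i => Fin.cases (continuousOn_iff_continuous_domRestrict.1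
        hF.continuousOn) (fun a => (continuous_apply a).comp continuous_subtype_val) i
    · exact Topology.IsEmbedding.subtypeVal
  isometric := fun p _ => by rw [associatedMetric_eq_pullback]

/-! ### The parallel vector field `∂_{x^0}` -/

lemma tail_single_zero (c : ℝ) : Fin.tail (Pi.single 0 c : Fin (n + 1) → ℝ) = 0 := by
  ext i
  simp [Fin.tail]

lemma isUnitNormalOn_single_zero (hq : 0 < q) (hD : IsOpen D) (hF : ContDiffOn ℝ ∞ F D) :
    IsUnitNormalOn (twistedMetric (semiEuclideanMetric (n + 1) q) (uccRigging q F) (fun _ => 1))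
      (mongeMap F) (fun _ => Pi.single 0 √2) D where
  smooth := contDiffOn_const
  normal := fun p hp u => by
    have hd := (hF.differentiableOn (by simp)).differentiableAt (hD.mem_nhds hp)
    rw [twistedMetric_uccRigging hq, fderiv_mongeMap hd, tail_single_zero]
    simp only [mongeMap, Fin.cons_zero, Fin.tail_cons, map_zero, LinearMap.zero_apply,
      Pi.single_eq_same]
    ring
  unit := fun p _ => by
    have hs : √2 * √2 = (2 : ℝ) := Real.mul_self_sqrt (by norm_num)
    rw [twistedMetric_uccRigging hq, tail_single_zero]
    simp only [map_zero, Pi.single_eq_same, add_zero]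
    rw [show -(√2 * √2) + 1 / 2 * √2 * √2 = (-1 : ℝ) by linear_combination (-1 / 2) * hs]
    norm_num

/-- Against a tangent vector `(dF(w), w)` the `d 0` terms cancel, leaving `h + dF²` evaluated at
`Fin.tail d` and `w`; that form is non-degenerate. -/
lemma tail_eq_zero_of_unitNormal (hq : 0 < q) {p : Fin n → ℝ} (hF : DifferentiableAt ℝ F p)
    (hgrad : fderiv ℝ F p (tailGrad q F p) = 1) {d : Fin (n + 1) → ℝ}
    (hd : ∀ u, twistedMetric (semiEuclideanMetric (n + 1) q) (uccRigging q F) (fun _ => 1)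
      (mongeMap F p) d (fderiv ℝ (mongeMap F) p u) = 0) : Fin.tail d = 0 := by
  refine eq_zero_of_forall_add_mul_eq_zero (tailForm n q) (tailGrad q F p) (tailForm_symm n q)
    tailForm_nondegenerate ?_ _ fun w => ?_
  · rw [tailForm_tailGrad, hgrad]; norm_num
  · have h := hd w
    rw [twistedMetric_uccRigging hq, fderiv_mongeMap hF] at h
    simp only [mongeMap, Fin.cons_zero, Fin.tail_cons] at h
    rw [tailForm_tailGrad, tailForm_tailGrad]
    linear_combination h

lemma hasFDerivAt_fderiv_tail_apply {y : Fin (n + 1) → ℝ} (hF : ContDiffAt ℝ ∞ F (Fin.tail y))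
    (w : Fin n → ℝ) :
    ∃ L : (Fin (n + 1) → ℝ) →L[ℝ] ℝ,
      HasFDerivAt (fun z : Fin (n + 1) → ℝ => fderiv ℝ F (Fin.tail z) w) L y ∧
      ∀ v, L v = fderiv ℝ (fderiv ℝ F) (Fin.tail y) (Fin.tail v) w := by
  let T : (Fin (n + 1) → ℝ) →L[ℝ] (Fin n → ℝ) :=
    ContinuousLinearMap.pi fun i => ContinuousLinearMap.proj i.succ
  have h1 : HasFDerivAt (fderiv ℝ F) (fderiv ℝ (fderiv ℝ F) (Fin.tail y)) (T y) :=
    ((hF.fderiv_right (m := 1) (by norm_cast)).differentiableAt (by simp)).hasFDerivAt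
  exact ⟨_, (h1.comp y T.hasFDerivAt).clm_apply (hasFDerivAt_const w y), fun v => by simp; rfl⟩

/-- In each summand `∂_0 g_{il}` vanishes, and `∂_i g_{0l} - ∂_l g_{i0}` is an antisymmetrised
second derivative of `F`. -/
lemma christoffel_twistedMetric_zero (hq : 0 < q) {y : Fin (n + 1) → ℝ}
    (hF : ContDiffAt ℝ ∞ F (Fin.tail y)) (k i : Fin (n + 1)) :
    christoffel (twistedMetric (semiEuclideanMetric (n + 1) q) (uccRigging q F) (fun _ => 1))
      y k i 0 = 0 := by
  choose L hL hLv using fun w => hasFDerivAt_fderiv_tail_apply hF w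
  have hsymm := (hF.isSymmSndFDerivAt (by simp; norm_cast)).eq
  set e : Fin (n + 1) → Fin (n + 1) → ℝ := fun j => Pi.single j 1
  have hcomp : ∀ j l, HasFDerivAt (fun z => components
      (twistedMetric (semiEuclideanMetric (n + 1) q) (uccRigging q F) (fun _ => 1)) z j l)
      ((1 / 2 * (e j 0 + fderiv ℝ F (Fin.tail y) (Fin.tail (e j)))) • L (Fin.tail (e l))
        + (e l 0 + fderiv ℝ F (Fin.tail y) (Fin.tail (e l))) •
          ((1 / 2 : ℝ) • L (Fin.tail (e j)))) y := by
    intro j l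
    simp only [components, Matrix.of_apply, twistedMetric_uccRigging hq]
    exact ((((hL (Fin.tail (e j))).const_add (e j 0)).const_mul (1 / 2)).mul
      ((hL (Fin.tail (e l))).const_add (e l 0))).const_add _
  have he : Fin.tail (e 0) = 0 := tail_single_zero 1
  have he0 : e 0 0 = 1 := by simp [e]
  rw [christoffel, Finset.sum_eq_zero, mul_zero]
  intro l _
  simp only [partialDeriv, (hcomp _ _).fderiv, add_apply,
    smul_apply, hLv, smul_eq_mul]
  rw [he, he0, hsymm (Fin.tail (e l)) (Fin.tail (e i))]
  simp only [map_zero, zero_apply]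
  ring

lemma fderiv_eq_zero_of_sq_eq_const {f : (Fin n → ℝ) → ℝ} {p : Fin n → ℝ} {c : ℝ} (hc : c ≠ 0)
    (hf : DifferentiableAt ℝ f p) (h : ∀ᶠ x in nhds p, f x * f x = c) : fderiv ℝ f p = 0 := by
  have h1 : fderiv ℝ (fun x => f x * f x) p = 0 := by
    rw [Filter.EventuallyEq.fderiv_eq (f := fun _ => c) h]; simp
  rw [fderiv_fun_mul hf hf, ← two_smul ℝ, smul_smul] at h1
  refine (smul_eq_zero.1 h1).resolve_left fun h2 => hc ?_
  rw [← h.self_of_nhds, (mul_eq_zero.1 h2).resolve_left two_ne_zero, zero_mul]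

lemma isTotallyGeodesic_mongeMap (hq : 0 < q) (hD : IsOpen D) (hF : ContDiffOn ℝ ∞ F D)
    (hgrad : ∀ p ∈ D, fderiv ℝ F p (tailGrad q F p) = 1) :
    IsTotallyGeodesic D
      (twistedMetric (semiEuclideanMetric (n + 1) q) (uccRigging q F) (fun _ => 1))
      (mongeMap F) := by
  intro V δ hV hVD hδ p hp u
  have htail : ∀ x ∈ V, Fin.tail (δ x) = 0 := fun x hx =>
    tail_eq_zero_of_unitNormal hq
      ((hF.differentiableOn (by simp)).differentiableAt (hD.mem_nhds (hVD hx)))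
      (hgrad x (hVD hx)) (hδ.normal x hx)
  -- A multiple `t ∂_{x⁰}` has square `-t²/2`, so the unit condition forces `t² = 2`.
  have hsq : ∀ x ∈ V, δ x 0 * δ x 0 = 2 := by
    intro x hx
    have h := hδ.unit x hx
    rw [twistedMetric_uccRigging hq, htail x hx] at h
    simp only [map_zero, add_zero] at h
    rw [abs_of_nonpos (by nlinarith [mul_self_nonneg (δ x 0)])] at h
    linarith
  have hdiff : DifferentiableAt ℝ δ p :=
    (hδ.smooth.differentiableOn (by simp)).differentiableAt (hV.mem_nhds hp)
  have hnhds : ∀ᶠ x in nhds p, x ∈ V := hV.mem_nhds hp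
  have hzero : ∀ k, fderiv ℝ δ p u k = 0 := by
    intro k
    have h1 : fderiv ℝ δ p u k = fderiv ℝ (fun x => δ x k) p u := by
      rw [fderiv_apply hdiff]
      rfl
    rw [h1]
    refine Fin.cases ?_ (fun a => ?_) k
    · rw [fderiv_eq_zero_of_sq_eq_const two_ne_zero (differentiableAt_pi.1 hdiff 0)
        (hnhds.mono hsq)]
      rfl
    · have h2 : (fun x => δ x a.succ) =ᶠ[nhds p] fun _ => 0 :=
        hnhds.mono fun x hx => congrFun (htail x hx) a
      rw [h2.fderiv_eq]
      simp
  have hFp : ContDiffAt ℝ ∞ F (Fin.tail (mongeMap F p)) := by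
    simpa [mongeMap] using hF.contDiffAt (hD.mem_nhds (hVD hp))
  ext k
  simp only [shapeOperator, covDerivAlong, Pi.neg_apply, Pi.zero_apply, hzero, zero_add,
    neg_eq_zero]
  refine Finset.sum_eq_zero fun i _ => Finset.sum_eq_zero fun j _ => ?_
  refine Fin.cases ?_ (fun a => ?_) j
  · rw [christoffel_twistedMetric_zero hq hFp, zero_mul, zero_mul]
  · rw [show δ p a.succ = 0 from congrFun (htail p hp) a, mul_zero]

end Monge

theorem mainTheorem11 (n q : ℕ) (hq : 0 < q) (hqn : q ≤ n + 1)
    (D : Set (Fin n → ℝ)) (hD : IsOpen D)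
    (F : (Fin n → ℝ) → ℝ) (hF : ContDiffOn ℝ ∞ F D) (hF0 : ∀ p ∈ D, F p ≠ 0)
    (hnull : IsNullOn (pullback (mongeMap F) (semiEuclideanMetric (n + 1) q)) D) :
    IsNondegenerateHypersurface D
      (associatedMetric (mongeMap F) (semiEuclideanMetric (n + 1) q) (uccRigging q F) (fun _ => 1))
      (cylinder D)
      (twistedMetric (semiEuclideanMetric (n + 1) q) (uccRigging q F) (fun _ => 1))
      (mongeMap F) ∧
    (∃ δ, IsUnitNormalOn
      (twistedMetric (semiEuclideanMetric (n + 1) q) (uccRigging q F) (fun _ => 1))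
      (mongeMap F) δ D) ∧
    IsTotallyGeodesic D
      (twistedMetric (semiEuclideanMetric (n + 1) q) (uccRigging q F) (fun _ => 1))
      (mongeMap F) := by
  have hgrad : ∀ p ∈ D, fderiv ℝ F p (tailGrad q F p) = 1 := fun p hp =>
    fderiv_tailGrad_of_null hq
      ((hF.differentiableOn (by simp)).differentiableAt (hD.mem_nhds hp)) (hnull p hp)
  exact ⟨isNondegenerateHypersurface_mongeMap hq hD hF hgrad,
    ⟨_, isUnitNormalOn_single_zero hq hD hF⟩, isTotallyGeodesic_mongeMap hq hD hF hgrad⟩
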